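/- Fix constants $\lambda>0$, $w_0>0$, and let $d=d(n)$ be a sequence of dimensions with $d=\omega(\log n)$, i.e. $\log n/d(n)\to 0$. Let $G=G_n$ be the standard geometric inhomogeneous random graph with parameters $n$, $\beta=3$, $w_0$, $d$: each of the $n$ vertices $v$ independently receives a weight $w_v$ with $\Pr[w_v\le x]=1-(x/w_0)^{1-\beta}=1-(x/w_0)^{-2}$ for $x\ge w_0$, and, independently, a position $\mathbf{x}_v$ uniform on the torus $\mathbb{T}^d=(\mathbb{R}/\mathbb{Z})^d$; two distinct vertices $u,v$ are adjacent if and only if their $L_\infty$-distance on the torus (the maximum over the coordinates of the distance on the circle of circumference $1$) is at most $$t_{uv}=\frac12\left(\frac{\lambda w_uw_v}{n}\right)^{1/d}.$$ Let $K_4$ be the number of $4$-cliques (complete subgraphs on four vertices) of $G$, and let $\omega(G)$ be the size of its largest clique. Then: 1. $K_4$ is bounded in probability (tight): for every $\varepsilon>0$ there is a constant $c$ such that $\Pr[K_4\ge c]\le\varepsilon$ for all $n$. 2. Consequently $\omega(G)=\mathcal{O}(1)$ in probability: for every $\varepsilon>0$ there is a constant $c$ such that $\Pr[\omega(G)\ge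 c]\le\varepsilon$ for all $n$. Moreover, for every function $f$ with $f(n)\to\infty$, $\Pr[\omega(G)\ge f(n)]\to 0$ as $n\to\infty$. -/

import Mathlib

open MeasureTheory ProbabilityTheory Filter Topology Asymptotics

noncomputable section

/-- A vertex sample: its weight and its position on the `d`-dimensional torus.
The metric on `UnitAddTorus (Fin d)` is the `L_∞` metric, i.e. the maximum over the coordinates of
the distance on the circle of circumference `1`. -/
abbrev VertexSample (d : ℕ) : Type := ℝ × UnitAddTorus (Fin d)

/-- The law of one vertex: the weight is Pareto distributed with
`P(w ≤ x) = 1 - (x / w₀) ^ (1 - β)` for `x ≥ w₀`, and, independently of it, the position is uniform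
on the torus. -/
def vertexLaw (β w₀ : ℝ) (d : ℕ) : Measure (VertexSample d) :=
  (paretoMeasure w₀ (β - 1)).prod (volume : Measure (UnitAddTorus (Fin d)))

/-- The joint law of `n` independent vertices. -/
def sampleLaw (n : ℕ) (β w₀ : ℝ) (d : ℕ) : Measure (Fin n → VertexSample d) :=
  Measure.pi fun _ => vertexLaw β w₀ d

theorem isProbabilityMeasure_sampleLaw (n : ℕ) {β w₀ : ℝ} (hβ : 1 < β) (hw₀ : 0 < w₀) (d : ℕ) :
    IsProbabilityMeasure (sampleLaw n β w₀ d) := by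
  have := isProbabilityMeasure_paretoMeasure hw₀ (sub_pos.mpr hβ)
  have : IsProbabilityMeasure (volume : Measure UnitAddCircle) := ⟨UnitAddCircle.measure_univ⟩
  have : IsProbabilityMeasure (volume : Measure (UnitAddTorus (Fin d))) := by
    rw [volume_pi]
    infer_instance
  unfold sampleLaw vertexLaw
  infer_instance

/-- The connection threshold `t_{uv} = (1/2) (λ w_u w_v / n)^(1/d)`. -/
def connectionThreshold (n d : ℕ) (lam wu wv : ℝ) : ℝ :=
  (1 / 2) * (lam * wu * wv / (n : ℝ)) ^ (1 / (d : ℝ))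

/-- The standard geometric inhomogeneous random graph as a function of the sampled weights and
positions: distinct vertices are adjacent iff their torus distance is at most the connection
threshold. Its law is obtained by drawing the samples from `sampleLaw n β w₀ d`. -/
def girg (n d : ℕ) (lam : ℝ) (x : Fin n → VertexSample d) : SimpleGraph (Fin n) where
  Adj u v := u ≠ v ∧ dist (x u).2 (x v).2 ≤ connectionThreshold n d lam (x u).1 (x v).1
  symm := ⟨fun u v h => ⟨h.1.symm, by
    have h2 := h.2
    rw [dist_comm]
    unfold connectionThreshold at h2 ⊢
    rwa [mul_right_comm lam]⟩⟩
  loopless := ⟨fun _ h => h.1 rfl⟩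

/-- The number `K_k` of `k`-cliques of a graph. -/
def cliqueCount {V : Type*} (G : SimpleGraph V) (k : ℕ) : ℕ := (G.cliqueSet k).ncard

end

/-! The expected number of 4-cliques is bounded for large `n`, and Markov's inequality gives
tightness; so it suffices that four given vertices form a clique with probability O(n⁻⁴).

Fix the weights and put κ_ij = λ w_i w_j / n. As the distance is a maximum over coordinates, the
clique probability is p^d, with p the probability that four uniform points of the circle respect all
six thresholds. The events "pair e is too far apart" are not mutually independent but are pairwise
independent, so a second moment argument gives p ≤ 1/(1+S), where S = ∑ (1 - min(1, κ_e^(1/d))).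
Since log n = o(d), each term of S is small for large `n`, and p^d ≤ ∏ min(1, κ_e)^(5/6). Thus
pairwise independence costs only an exponent 5/6 compared with full independence.

Put u_i = √(λ/n) w_i, so κ_ij = u_i u_j. The edge product is at most ∏ u_i² exp(-|log u_i|/6)
(`sum_pair_min_zero_le`). For β = 3 the square is the borderline moment, and the extra decay on both
sides of u = 1 makes each vertex contribute O(1/n) with no logarithm
(`lintegral_weightFactor_paretoMeasure_le`). The fourth power is O(n⁻⁴).

A large clique contains many 4-cliques, which gives the claims on the clique number. -/

/-! ### Second moment bound and product measures -/

theorem measureReal_iInter_compl_le_of_pairwise_indep {Ω ι : Type*} [MeasurableSpace Ω]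
    {μ : Measure Ω} [IsProbabilityMeasure μ] (s : Finset ι) {F : ι → Set Ω}
    (hF : ∀ i, MeasurableSet (F i))
    (hind : ∀ i ∈ s, ∀ j ∈ s, i ≠ j → μ.real (F i ∩ F j) = μ.real (F i) * μ.real (F j)) :
    μ.real (⋂ i ∈ s, (F i)ᶜ) ≤ (1 + ∑ i ∈ s, μ.real (F i))⁻¹ := by
  classical
  set S := ∑ i ∈ s, μ.real (F i) with hS
  have hS0 : 0 ≤ S := Finset.sum_nonneg fun i _ => measureReal_nonneg
  set c := (1 + S)⁻¹ with hc
  set N : Ω → ℝ := fun ω => ∑ i ∈ s, (F i).indicator 1 ω with hN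
  have hi (A : Set Ω) (hA : MeasurableSet A) : Integrable (A.indicator (1 : Ω → ℝ)) μ :=
    (integrable_const (1 : ℝ)).indicator hA
  have hNi : Integrable N μ := integrable_finsetSum _ fun i _ => hi _ (hF i)
  have hN2 : (fun ω => N ω ^ 2) =
      fun ω => ∑ i ∈ s, ∑ j ∈ s, (F i ∩ F j).indicator (1 : Ω → ℝ) ω := by
    funext ω
    simp only [hN, sq, Finset.sum_mul_sum]
    simp_rw [Set.inter_indicator_one]
    rfl
  have hN2i : Integrable (fun ω => N ω ^ 2) μ := by
    rw [hN2]
    exact integrable_finsetSum _ fun i _ => integrable_finsetSum _ fun j _ =>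
      hi _ ((hF i).inter (hF j))
  have hEN : ∫ ω, N ω ∂μ = S := by
    simp only [hN]
    rw [integral_finsetSum _ fun i _ => hi _ (hF i)]
    exact Finset.sum_congr rfl fun i _ => integral_indicator_one (hF i)
  have hEN2 : ∫ ω, N ω ^ 2 ∂μ ≤ S + S ^ 2 := by
    rw [hN2, integral_finsetSum _ fun i _ => integrable_finsetSum _ fun j _ =>
      hi _ ((hF i).inter (hF j))]
    have h1 : S + S ^ 2 = ∑ i ∈ s, (μ.real (F i) + ∑ j ∈ s, μ.real (F i) * μ.real (F j)) := by
      rw [Finset.sum_add_distrib, sq, hS, Finset.sum_mul_sum]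
    rw [h1]
    refine Finset.sum_le_sum fun i his => ?_
    rw [integral_finsetSum _ fun j _ => hi _ ((hF i).inter (hF j))]
    have h2 : ∑ j ∈ s, (if j = i then μ.real (F i) else 0) = μ.real (F i) := by
      simp [his]
    refine le_of_le_of_eq ?_ (congrArg (· + ∑ j ∈ s, μ.real (F i) * μ.real (F j)) h2)
    rw [← Finset.sum_add_distrib]
    refine Finset.sum_le_sum fun j hjs => ?_
    rw [integral_indicator_one ((hF i).inter (hF j))]
    by_cases hij : j = i
    · subst hij
      simp only [Set.inter_self, if_true]
      have : 0 ≤ μ.real (F j) * μ.real (F j) := mul_self_nonneg _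
      linarith
    · rw [hind i his j hjs (Ne.symm hij), if_neg hij, zero_add]
  have hmeas : MeasurableSet (⋂ i ∈ s, (F i)ᶜ) :=
    Finset.measurableSet_biInter _ fun i _ => (hF i).compl
  calc μ.real (⋂ i ∈ s, (F i)ᶜ)
      = ∫ ω, (⋂ i ∈ s, (F i)ᶜ).indicator (1 : Ω → ℝ) ω ∂μ := (integral_indicator_one hmeas).symm
    -- The indicator of N = 0 is at most (1 - cN)²; the choice c = 1/(1+S) minimises the resulting
    -- bound.
    _ ≤ ∫ ω, (1 - 2 * c * N ω + c ^ 2 * N ω ^ 2) ∂μ := by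
        refine integral_mono (hi _ hmeas)
          (((integrable_const _).sub (hNi.const_mul _)).add (hN2i.const_mul _)) fun ω => ?_
        by_cases hω : ω ∈ ⋂ i ∈ s, (F i)ᶜ
        · have : N ω = 0 := by
            simp only [hN]
            refine Finset.sum_eq_zero fun i hi => ?_
            simp only [Set.mem_iInter] at hω
            exact Set.indicator_of_notMem (hω i hi) _
          simp [this, Set.indicator_of_mem hω]
        · rw [Set.indicator_of_notMem hω]
          nlinarith [sq_nonneg (1 - c * N ω)]
    _ = 1 - 2 * c * S + c ^ 2 * ∫ ω, N ω ^ 2 ∂μ := by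
        have h1 : Integrable (fun ω => 1 - 2 * c * N ω) μ :=
          (integrable_const _).sub (hNi.const_mul _)
        rw [integral_add h1 (hN2i.const_mul _),
          integral_sub (integrable_const _) (hNi.const_mul _), integral_const_mul,
          integral_const_mul, hEN]
        simp
    _ ≤ 1 - 2 * c * S + c ^ 2 * (S + S ^ 2) := by gcongr
    _ = c := by
        rw [hc]
        field_simp
        ring

/-- Resampling one coordinate independently leaves a product law unchanged; this serves to integrate
out a single point. -/
theorem measurePreserving_update {ι : Type*} [Fintype ι] [DecidableEq ι] {X : ι → Type*}
    [∀ i, MeasurableSpace (X i)] (μ : ∀ i, Measure (X i)) [∀ i, IsProbabilityMeasure (μ i)]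
    (s : ι) :
    MeasurePreserving (fun a : (∀ i, X i) × X s => Function.update a.1 s a.2)
      ((Measure.pi μ).prod (μ s)) (Measure.pi μ) := by
  have hm : Measurable (fun a : (∀ i, X i) × X s => Function.update a.1 s a.2) := by
    refine measurable_pi_iff.mpr fun i => ?_
    by_cases h : i = s
    · subst h
      simpa using measurable_snd
    · simp only [Function.update_of_ne h]
      fun_prop
  refine ⟨hm, (Measure.pi_eq fun A hA => ?_).symm⟩
  rw [Measure.map_apply hm (MeasurableSet.univ_pi hA)]
  have : (fun a : (∀ i, X i) × X s => Function.update a.1 s a.2) ⁻¹' (Set.univ.pi A) =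
      (Set.univ.pi (Function.update A s Set.univ)) ×ˢ (A s) := by
    ext a
    simp only [Set.mem_preimage, Set.mem_pi, Set.mem_univ, true_imp_iff, Set.mem_prod]
    constructor
    · intro h
      refine ⟨fun i => ?_, by simpa using h s⟩
      by_cases hi : i = s
      · subst hi; simp
      · simpa [Function.update_of_ne hi] using h i
    · rintro ⟨h, h'⟩ i
      by_cases hi : i = s
      · subst hi; simpa using h'
      · simpa [Function.update_of_ne hi] using h i
  rw [this, Measure.prod_prod, Measure.pi_pi, ← Finset.prod_erase_mul _ _ (Finset.mem_univ s),
    ← Finset.prod_erase_mul (a := s) _ (fun i => μ i (A i)) (Finset.mem_univ s)]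
  simp only [Function.update_self, measure_univ, mul_one]
  congr 1
  refine Finset.prod_congr rfl fun i hi => ?_
  rw [Function.update_of_ne (Finset.ne_of_mem_erase hi)]

theorem measurePreserving_pi_precomp {ι κ X : Type*} [Fintype ι] [Fintype κ] [MeasurableSpace X]
    (μ : Measure X) [IsProbabilityMeasure μ] {e : κ → ι} (he : Function.Injective e) :
    MeasurePreserving (fun (x : ι → X) k => x (e k)) (Measure.pi fun _ => μ)
      (Measure.pi fun _ => μ) := by
  refine ⟨by fun_prop, ?_⟩
  have h := (iIndepFun_pi (μ := fun _ : ι => μ) (X := fun _ x => x)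
    fun _ => aemeasurable_id).precomp he
  rw [iIndepFun_iff_map_fun_eq_pi_map fun k => (measurable_pi_apply _).aemeasurable] at h
  rw [h]
  congr 1
  funext k
  exact (measurePreserving_eval (fun _ : ι => μ) (e k)).map_eq

/-- Both sides are curried forms of the product over pairs of indices. Transposing vertices and
torus coordinates lets the clique event factor over coordinates. -/
theorem measurePreserving_piSwap {ι κ X : Type*} [Fintype ι] [Fintype κ] [MeasurableSpace X]
    (μ : Measure X) [IsProbabilityMeasure μ] :
    MeasurePreserving (fun (x : ι → κ → X) k i => x i k)
      (Measure.pi fun _ => Measure.pi fun _ => μ) (Measure.pi fun _ => Measure.pi fun _ => μ) := by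
  refine ⟨by fun_prop, ?_⟩
  have h1 := Measure.infinitePi_map_curry (fun (_ : ι) (_ : κ) => μ)
  have h2 := Measure.infinitePi_map_curry (fun (_ : κ) (_ : ι) => μ)
  simp only [Measure.infinitePi_eq_pi] at h1 h2
  rw [← h1, ← h2, Measure.map_map (by fun_prop) (MeasurableEquiv.measurable _)]
  rw [← (measurePreserving_pi_precomp (ι := ι × κ) μ
    (e := (Prod.swap : κ × ι → ι × κ)) Prod.swap_injective).map_eq,
    Measure.map_map (MeasurableEquiv.measurable _) (by fun_prop)]
  rfl

theorem lintegral_pi_prod_eq_prod_lintegral {ι X : Type*} [Fintype ι] [MeasurableSpace X]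
    (μ : Measure X) [IsProbabilityMeasure μ] {g : X → ENNReal} (hg : Measurable g) :
    ∫⁻ x : ι → X, ∏ i, g (x i) ∂(Measure.pi fun _ => μ) = (∫⁻ x, g x ∂μ) ^ Fintype.card ι := by
  have h := iIndepFun_pi (μ := fun _ : ι => μ) (X := fun _ => g) fun _ => hg.aemeasurable
  rw [lintegral_prod_eq_prod_lintegral_of_indepFun Finset.univ _ h
    fun i => hg.comp (measurable_pi_apply i)]
  have (i : ι) : ∫⁻ x : ι → X, g (x i) ∂(Measure.pi fun _ => μ) = ∫⁻ x, g x ∂μ :=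
    (measurePreserving_eval (fun _ : ι => μ) i).lintegral_comp hg
  simp [this]

/-! ### Elementary inequalities: from edges to vertices -/

/-- The pointwise inequality that turns a bound for a pair product into a product of one-vertex
bounds. -/
theorem sum_pair_min_zero_le (y : Fin 4 → ℝ) :
    5 / 6 * ∑ e : Fin 4 × Fin 4 with e.1 < e.2, min 0 (y e.1 + y e.2) ≤
      ∑ i, (2 * y i - |y i| / 6) := by
  have hu : (Finset.univ.filter fun e : Fin 4 × Fin 4 => e.1 < e.2) =
      {(0, 1), (0, 2), (0, 3), (1, 2), (1, 3), (2, 3)} := by decide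
  -- Each vertex lies in three pairs, so slope 2/3 yields the 2 y_i; the surplus 5/6 - 2/3 = 1/6
  -- pays for the absolute value.
  have key (s : ℝ) : 5 / 6 * min 0 s ≤ 2 / 3 * s - |s| / 6 := by
    rcases le_total 0 s with h | h
    · rw [min_eq_left h, abs_of_nonneg h]; linarith
    · rw [min_eq_right h, abs_of_nonpos h]; linarith
  -- Applied to the four triangles of K₄, each edge occurs twice, whence ∑ |y_i| ≤ ∑ |y_i + y_j|.
  have tri (a b c : ℝ) : 2 * |a| ≤ |a + b| + |a + c| + |b + c| := by
    have h1 := abs_sub (a + b + (a + c)) (b + c)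
    have h2 := abs_add_le (a + b) (a + c)
    have h3 : a + b + (a + c) - (b + c) = 2 * a := by ring
    rw [h3, abs_mul, abs_two] at h1
    linarith
  rw [hu, Fin.sum_univ_four]
  simp only [Finset.mul_sum]
  rw [Finset.sum_insert (by decide), Finset.sum_insert (by decide), Finset.sum_insert (by decide),
    Finset.sum_insert (by decide), Finset.sum_insert (by decide), Finset.sum_singleton]
  have := tri (y 0) (y 1) (y 2)
  have := tri (y 1) (y 2) (y 3)
  have := tri (y 2) (y 3) (y 0)
  have := tri (y 3) (y 0) (y 1)
  simp only [add_comm (y 2) (y 0), add_comm (y 3) (y 0), add_comm (y 3) (y 1)] at *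
  have := key (y 0 + y 1)
  have := key (y 0 + y 2)
  have := key (y 0 + y 3)
  have := key (y 1 + y 2)
  have := key (y 1 + y 3)
  have := key (y 2 + y 3)
  linarith

/-- To first order the two sides are 1 - L and 1 - 5L/6, with L = ∑ l_i. The bound 1/35 gives L ≤
6/35, exactly where (1 + 35L/36)(1 - 5L/6) ≥ 1 stops holding. -/
theorem inv_one_add_sum_one_sub_exp_neg_le {ι : Type*} (s : Finset ι) (hs : s.card ≤ 6)
    {l : ι → ℝ} (h0 : ∀ i ∈ s, 0 ≤ l i) (h1 : ∀ i ∈ s, l i ≤ 1 / 35) :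
    (1 + ∑ i ∈ s, (1 - Real.exp (-l i)))⁻¹ ≤ Real.exp (-(5 / 6 * ∑ i ∈ s, l i)) := by
  set L := ∑ i ∈ s, l i
  have hL0 : 0 ≤ L := Finset.sum_nonneg h0
  have hL1 : L ≤ 6 / 35 := by
    have := Finset.sum_le_card_nsmul s l _ h1
    rw [nsmul_eq_mul] at this
    have h6 : (s.card : ℝ) ≤ 6 := by exact_mod_cast hs
    linarith
  have hS : 35 / 36 * L ≤ ∑ i ∈ s, (1 - Real.exp (-l i)) := by
    rw [Finset.mul_sum]
    refine Finset.sum_le_sum fun i hi => ?_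
    have h2 : Real.exp (-l i) ≤ (1 + l i)⁻¹ := by
      rw [Real.exp_neg]
      exact inv_anti₀ (by linarith [h0 i hi]) (by linarith [Real.add_one_le_exp (l i)])
    have h3 : (1 + l i)⁻¹ ≤ 1 - 35 / 36 * l i := by
      rw [inv_le_iff_one_le_mul₀ (by linarith [h0 i hi])]
      nlinarith [h0 i hi, h1 i hi]
    linarith
  rw [Real.exp_neg]
  refine inv_anti₀ (Real.exp_pos _) ?_
  have h4 : Real.exp (5 / 6 * L) ≤ (1 - 5 / 6 * L)⁻¹ := by
    rw [← inv_inv (Real.exp _), ← Real.exp_neg]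
    exact inv_anti₀ (by linarith) (by linarith [Real.add_one_le_exp (-(5 / 6 * L))])
  have h5 : (1 - 5 / 6 * L)⁻¹ ≤ 1 + 35 / 36 * L := by
    rw [inv_le_iff_one_le_mul₀ (by linarith)]
    nlinarith
  linarith

/-! ### The one-vertex Pareto integral -/

/-- The one-vertex weight factor `min (u ^ (2 - 1 / 6)) (u ^ (2 + 1 / 6))`, in exponential form. -/
noncomputable def weightFactor (u : ℝ) : ℝ := Real.exp (2 * Real.log u - |Real.log u| / 6)

theorem measurable_weightFactor : Measurable weightFactor := by
  unfold weightFactor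
  have h : Measurable fun u : ℝ => |Real.log u| := Real.measurable_log.abs
  exact Real.measurable_exp.comp ((Real.measurable_log.const_mul 2).sub (h.div_const 6))

theorem weightFactor_le_rpow_of_pos {u : ℝ} (hu : 0 < u) :
    weightFactor u ≤ u ^ (13 / 6 : ℝ) ∧ weightFactor u ≤ u ^ (11 / 6 : ℝ) := by
  unfold weightFactor
  rw [Real.rpow_def_of_pos hu, Real.rpow_def_of_pos hu]
  constructor <;> apply Real.exp_le_exp.mpr
  · linarith [neg_abs_le (Real.log u)]
  · linarith [le_abs_self (Real.log u)]

theorem lintegral_weightFactor_paretoMeasure_le {w₀ b : ℝ} (hw₀ : 0 < w₀) (hb : 0 < b) :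
    ∫⁻ w, ENNReal.ofReal (weightFactor (b * w)) ∂(paretoMeasure w₀ 2) ≤
      ENNReal.ofReal (24 * w₀ ^ 2 * b ^ 2) := by
  have hpt (w : ℝ) : paretoPDF w₀ 2 w * ENNReal.ofReal (weightFactor (b * w)) ≤
      (Set.Ioc 0 b⁻¹).indicator
        (fun w => ENNReal.ofReal (2 * w₀ ^ 2 * b ^ (13 / 6 : ℝ) * w ^ (-(5 / 6) : ℝ))) w +
      (Set.Ioi b⁻¹).indicator
        (fun w => ENNReal.ofReal (2 * w₀ ^ 2 * b ^ (11 / 6 : ℝ) * w ^ (-(7 / 6) : ℝ))) w := by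
    rcases lt_or_ge w w₀ with hw | hw
    · rw [paretoPDF_of_lt hw]; simp
    have hw' : 0 < w := hw₀.trans_le hw
    have hF := weightFactor_le_rpow_of_pos (mul_pos hb hw')
    rw [Real.mul_rpow hb.le hw'.le, Real.mul_rpow hb.le hw'.le] at hF
    have hc : 0 ≤ 2 * w₀ ^ (2 : ℝ) * w ^ (-(2 + 1) : ℝ) := by positivity
    rw [paretoPDF_of_le hw, ← ENNReal.ofReal_mul hc]
    -- The split is at u = bw = 1: exponent 13/6 is integrable against w⁻³ near 0, and 11/6 near
    -- infinity. Each side contributes 2 · 6 to the constant 24.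
    rcases le_or_gt w b⁻¹ with h | h
    · rw [Set.indicator_of_mem (show w ∈ Set.Ioc 0 b⁻¹ from ⟨hw', h⟩)]
      refine le_add_right (ENNReal.ofReal_le_ofReal ?_)
      refine (mul_le_mul_of_nonneg_left hF.1 hc).trans_eq ?_
      rw [show (-(5 / 6) : ℝ) = -(2 + 1) + 13 / 6 by norm_num, Real.rpow_add hw', Real.rpow_two]
      ring
    · rw [Set.indicator_of_mem (show w ∈ Set.Ioi b⁻¹ from h)]
      refine le_add_left (ENNReal.ofReal_le_ofReal ?_)
      refine (mul_le_mul_of_nonneg_left hF.2 hc).trans_eq ?_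
      rw [show (-(7 / 6) : ℝ) = -(2 + 1) + 11 / 6 by norm_num, Real.rpow_add hw', Real.rpow_two]
      ring
  have hbi : 0 < b⁻¹ := inv_pos.mpr hb
  have hI1 : ∫⁻ w in Set.Ioc 0 b⁻¹,
      ENNReal.ofReal (2 * w₀ ^ 2 * b ^ (13 / 6 : ℝ) * w ^ (-(5 / 6) : ℝ)) =
      ENNReal.ofReal (12 * w₀ ^ 2 * b ^ 2) := by
    have hint : IntegrableOn (fun w : ℝ => w ^ (-(5 / 6) : ℝ)) (Set.Ioc 0 b⁻¹) := by
      rw [← intervalIntegrable_iff_integrableOn_Ioc_of_le hbi.le]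
      exact intervalIntegral.intervalIntegrable_rpow' (by norm_num)
    rw [← ofReal_integral_eq_lintegral_ofReal (hint.const_mul _)]
    · rw [integral_const_mul, ← intervalIntegral.integral_of_le hbi.le,
        integral_rpow (Or.inl (by norm_num))]
      congr 1
      rw [show (-(5 / 6) + 1 : ℝ) = 1 / 6 by norm_num, Real.zero_rpow (by norm_num),
        Real.inv_rpow hb.le, ← Real.rpow_neg hb.le, sub_zero]
      have : b ^ (13 / 6 : ℝ) * b ^ (-(1 / 6) : ℝ) = b ^ 2 := by
        rw [← Real.rpow_add hb, ← Real.rpow_two]; norm_num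
      rw [← this]; ring
    · filter_upwards [ae_restrict_mem measurableSet_Ioc] with w hw
      have := hw.1
      change 0 ≤ _
      positivity
  have hI2 : ∫⁻ w in Set.Ioi b⁻¹,
      ENNReal.ofReal (2 * w₀ ^ 2 * b ^ (11 / 6 : ℝ) * w ^ (-(7 / 6) : ℝ)) =
      ENNReal.ofReal (12 * w₀ ^ 2 * b ^ 2) := by
    have hint : IntegrableOn (fun w : ℝ => w ^ (-(7 / 6) : ℝ)) (Set.Ioi b⁻¹) :=
      integrableOn_Ioi_rpow_of_lt (by norm_num) hbi
    rw [← ofReal_integral_eq_lintegral_ofReal (hint.const_mul _)]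
    · rw [integral_const_mul, integral_Ioi_rpow_of_lt (by norm_num) hbi]
      congr 1
      rw [show (-(7 / 6) + 1 : ℝ) = -(1 / 6) by norm_num,
        Real.inv_rpow hb.le, ← Real.rpow_neg hb.le, neg_neg]
      have : b ^ (11 / 6 : ℝ) * b ^ (1 / 6 : ℝ) = b ^ 2 := by
        rw [← Real.rpow_add hb, ← Real.rpow_two]; norm_num
      rw [← this]; ring
    · filter_upwards [ae_restrict_mem measurableSet_Ioi] with w hw
      have : 0 < w := hbi.trans hw
      change 0 ≤ _
      positivity
  have hwm : Measurable fun w => ENNReal.ofReal (weightFactor (b * w)) :=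
    (measurable_weightFactor.comp (measurable_const_mul b)).ennreal_ofReal
  have hpm : Measurable (paretoPDF w₀ 2) := (measurable_paretoPDFReal w₀ 2).ennreal_ofReal
  rw [paretoMeasure, lintegral_withDensity_eq_lintegral_mul _ hpm hwm]
  refine (lintegral_mono hpt).trans ?_
  have hm (c e : ℝ) : Measurable fun w : ℝ => ENNReal.ofReal (c * w ^ e) := by fun_prop
  rw [lintegral_add_left ((hm _ _).indicator measurableSet_Ioc),
    lintegral_indicator measurableSet_Ioc, lintegral_indicator measurableSet_Ioi, hI1, hI2,
    ← ENNReal.ofReal_add (by positivity) (by positivity)]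
  exact ENNReal.ofReal_le_ofReal (by linarith)

/-! ### Four points on the circle -/

theorem isProbabilityMeasure_volume_unitAddCircle :
    IsProbabilityMeasure (volume : Measure UnitAddCircle) := ⟨UnitAddCircle.measure_univ⟩

attribute [local instance] isProbabilityMeasure_volume_unitAddCircle

theorem measureReal_lt_dist_unitAddCircle (z : UnitAddCircle) (t : ℝ) (ht : 0 ≤ t) :
    volume.real {y : UnitAddCircle | t < dist z y} = 1 - min 1 (2 * t) := by
  have h : {y : UnitAddCircle | t < dist z y} = (Metric.closedBall z t)ᶜ := by
    ext y
    simp [dist_comm]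
  rw [h, probReal_compl_eq_one_sub Metric.isClosed_closedBall.measurableSet, measureReal_def,
    AddCircle.volume_closedBall, ENNReal.toReal_ofReal (by positivity)]

/-- Integrating out a coordinate `s` that the event `A` does not involve. -/
theorem measureReal_inter_lt_dist {ι : Type*} [Fintype ι] [DecidableEq ι] {r s : ι} (hrs : r ≠ s)
    {t : ℝ} (ht : 0 ≤ t) {A : Set (ι → UnitAddCircle)} (hA : MeasurableSet A)
    (hAs : ∀ y z, Function.update y s z ∈ A ↔ y ∈ A) :
    volume.real (A ∩ {y | t < dist (y r) (y s)}) = volume.real A * (1 - min 1 (2 * t)) := by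
  have hF : MeasurableSet {y : ι → UnitAddCircle | t < dist (y r) (y s)} :=
    measurableSet_lt measurable_const
      ((measurable_pi_apply r).dist (measurable_pi_apply s))
  have hmp := measurePreserving_update (fun _ : ι => (volume : Measure UnitAddCircle)) s
  have hpre : (fun a : (ι → UnitAddCircle) × UnitAddCircle => Function.update a.1 s a.2) ⁻¹'
      (A ∩ {y | t < dist (y r) (y s)}) = {a | a.1 ∈ A ∧ t < dist (a.1 r) a.2} := by
    ext a
    simp [hAs, Function.update_of_ne hrs]
  rw [measureReal_def, volume_pi, ← hmp.measure_preimage (hA.inter hF).nullMeasurableSet, hpre,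
    Measure.prod_apply (by rw [← hpre]; exact hmp.measurable (hA.inter hF))]
  have hsec (y : ι → UnitAddCircle) :
      volume (Prod.mk y ⁻¹' {a : (ι → UnitAddCircle) × UnitAddCircle |
        a.1 ∈ A ∧ t < dist (a.1 r) a.2}) =
      A.indicator (fun _ => ENNReal.ofReal (1 - min 1 (2 * t))) y := by
    by_cases hy : y ∈ A
    · rw [Set.indicator_of_mem hy, ← measureReal_lt_dist_unitAddCircle (y r) t ht,
        ofReal_measureReal]
      simp [hy]
    · simp [hy]
  simp_rw [hsec]
  rw [lintegral_indicator_const hA, ENNReal.toReal_mul,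
    ENNReal.toReal_ofReal (by linarith [min_le_left 1 (2 * t)]), mul_comm]
  rfl

theorem measureReal_forall_dist_le_le {t : Fin 4 × Fin 4 → ℝ} (ht : ∀ e, 0 ≤ t e) :
    volume.real {y : Fin 4 → UnitAddCircle |
        ∀ e : Fin 4 × Fin 4, e.1 < e.2 → dist (y e.1) (y e.2) ≤ t e} ≤
      (1 + ∑ e : Fin 4 × Fin 4 with e.1 < e.2, (1 - min 1 (2 * t e)))⁻¹ := by
  set E : Finset (Fin 4 × Fin 4) := {e | e.1 < e.2} with hE
  let F : Fin 4 × Fin 4 → Set (Fin 4 → UnitAddCircle) := fun e => {y | t e < dist (y e.1) (y e.2)}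
  have hF (e) : MeasurableSet (F e) := measurableSet_lt measurable_const
    ((measurable_pi_apply e.1).dist (measurable_pi_apply e.2))
  have hF' (e) (he : e ∈ E) : volume.real (F e) = 1 - min 1 (2 * t e) := by
    have h := measureReal_inter_lt_dist (r := e.1) (s := e.2) (Finset.mem_filter.mp he).2.ne (ht e)
      MeasurableSet.univ (fun _ _ => by simp)
    rwa [Set.univ_inter, probReal_univ, one_mul] at h
  have hind' (e) (f) (hf : f ∈ E) {a b : Fin 4}
      (hab : F e = {y | t e < dist (y a) (y b)}) (hne : a ≠ b) (hb1 : b ≠ f.1) (hb2 : b ≠ f.2) :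
      volume.real (F f ∩ F e) = volume.real (F f) * (1 - min 1 (2 * t e)) := by
    rw [hab]
    refine measureReal_inter_lt_dist hne (ht e) (hF f) fun y z => ?_
    simp only [F, Set.mem_ofPred_eq, Function.update_of_ne hb1.symm, Function.update_of_ne hb2.symm]
  have hind : ∀ e ∈ E, ∀ f ∈ E, e ≠ f →
      volume.real (F e ∩ F f) = volume.real (F e) * volume.real (F f) := by
    intro e he f hf hef
    rw [Set.inter_comm, mul_comm, hF' e he]
    have he' := (Finset.mem_filter.mp he).2
    have hf' := (Finset.mem_filter.mp hf).2
    -- Two distinct edges share at most one vertex, so some endpoint of e avoids f. Given all other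
    -- points it is uniform, and by translation invariance e is far with the same probability
    -- whatever they are.
    by_cases h2 : e.2 ≠ f.1 ∧ e.2 ≠ f.2
    · exact hind' e f hf rfl he'.ne h2.1 h2.2
    · refine hind' e f hf (a := e.2) (b := e.1) ?_ he'.ne' ?_ ?_
      · simp only [F, dist_comm]
      · intro h
        exact hef (Prod.ext h (by by_contra h'; exact h2 ⟨fun h3 => he'.ne (h.trans h3.symm), h'⟩))
      · intro h
        refine h2 ⟨fun h3 => ?_, fun h3 => he'.ne (h.trans h3.symm)⟩
        exact absurd (he'.trans_eq h3) (h ▸ hf'.le).not_gt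
  have := measureReal_iInter_compl_le_of_pairwise_indep (μ := volume) E hF hind
  rw [Finset.sum_congr rfl hF'] at this
  convert this using 2
  ext y
  simp [F, hE]

/-! ### Four points on the torus, for fixed weights -/

theorem volume_torus_forall_dist_le_le (d : ℕ) {t : Fin 4 × Fin 4 → ℝ} (ht : ∀ e, 0 ≤ t e) :
    (volume : Measure (Fin 4 → UnitAddTorus (Fin d)))
        {x | ∀ e : Fin 4 × Fin 4, e.1 < e.2 → dist (x e.1) (x e.2) ≤ t e} ≤
      ENNReal.ofReal
        ((1 + ∑ e : Fin 4 × Fin 4 with e.1 < e.2, (1 - min 1 (2 * t e)))⁻¹ ^ d) := by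
  set A := {y : Fin 4 → UnitAddCircle |
    ∀ e : Fin 4 × Fin 4, e.1 < e.2 → dist (y e.1) (y e.2) ≤ t e} with hA
  have hAm : MeasurableSet A := by
    have : A = ⋂ e : Fin 4 × Fin 4, ⋂ _ : e.1 < e.2, {y | dist (y e.1) (y e.2) ≤ t e} := by
      ext y; simp [hA]
    rw [this]
    exact MeasurableSet.iInter fun e => MeasurableSet.iInter fun _ =>
      measurableSet_le ((measurable_pi_apply e.1).dist (measurable_pi_apply e.2)) measurable_const
  have hmp := measurePreserving_piSwap (ι := Fin 4) (κ := Fin d) (volume : Measure UnitAddCircle)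
  have hset : {x : Fin 4 → UnitAddTorus (Fin d) |
      ∀ e : Fin 4 × Fin 4, e.1 < e.2 → dist (x e.1) (x e.2) ≤ t e} =
      (fun (x : Fin 4 → Fin d → UnitAddCircle) k i => x i k) ⁻¹' Set.univ.pi fun _ => A := by
    ext x
    simp only [hA, Set.mem_ofPred_eq, Set.mem_preimage, Set.mem_pi, Set.mem_univ, true_imp_iff]
    constructor
    · exact fun h k e he => (dist_pi_le_iff (ht e)).mp (h e he) k
    · exact fun h e he => (dist_pi_le_iff (ht e)).mpr fun k => h k e he
  rw [hset]
  refine (hmp.measure_preimage (MeasurableSet.univ_pi fun _ => hAm).nullMeasurableSet).trans_le ?_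
  rw [Measure.pi_pi, Finset.prod_const, Finset.card_univ, Fintype.card_fin,
    ← ofReal_measureReal, ← ENNReal.ofReal_pow measureReal_nonneg]
  exact ENNReal.ofReal_le_ofReal
    (pow_le_pow_left₀ measureReal_nonneg (measureReal_forall_dist_le_le ht) d)

theorem volume_torus_forall_dist_le_connectionThreshold_le {lam w₀ : ℝ} (hlam : 0 < lam)
    (hw₀ : 0 < w₀) {n d : ℕ} (hn : 0 < n) (hd : 0 < d)
    (hnd : Real.log (n / (lam * w₀ ^ 2)) ≤ d / 35) {w : Fin 4 → ℝ} (hw : ∀ i, w₀ ≤ w i) :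
    (volume : Measure (Fin 4 → UnitAddTorus (Fin d)))
        {x | ∀ e : Fin 4 × Fin 4, e.1 < e.2 →
          dist (x e.1) (x e.2) ≤ connectionThreshold n d lam (w e.1) (w e.2)} ≤
      ∏ i, ENNReal.ofReal (weightFactor (√(lam / n) * w i)) := by
  have hn' : (0 : ℝ) < n := by exact_mod_cast hn
  have hd' : (0 : ℝ) < d := by exact_mod_cast hd
  have hwp (i) : 0 < w i := hw₀.trans_le (hw i)
  have hb : 0 < √(lam / n) := Real.sqrt_pos.mpr (by positivity)
  set y : Fin 4 → ℝ := fun i => Real.log (√(lam / n) * w i) with hy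
  have hκpos (e : Fin 4 × Fin 4) : 0 < lam * w e.1 * w e.2 / n :=
    div_pos (mul_pos (mul_pos hlam (hwp _)) (hwp _)) hn'
  have hκ (e : Fin 4 × Fin 4) : Real.log (lam * w e.1 * w e.2 / n) = y e.1 + y e.2 := by
    rw [hy, ← Real.log_mul (mul_pos hb (hwp _)).ne' (mul_pos hb (hwp _)).ne']
    congr 1
    rw [mul_mul_mul_comm, Real.mul_self_sqrt (by positivity)]
    ring
  -- Chosen so that exp(-l_e) = min(1, κ_e^(1/d)); raising to the power d later cancels the division
  -- by d.
  let l : Fin 4 × Fin 4 → ℝ := fun e => -(min 0 (y e.1 + y e.2) / d)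
  have hl (e : Fin 4 × Fin 4) :
      1 - min 1 (2 * connectionThreshold n d lam (w e.1) (w e.2)) = 1 - Real.exp (-l e) := by
    unfold connectionThreshold
    have hmin : min 0 (y e.1 + y e.2) / d = min 0 ((y e.1 + y e.2) * (1 / d)) := by
      rw [mul_one_div, ← zero_div (d : ℝ), min_div_div_right hd'.le, zero_div]
    rw [← mul_assoc, mul_one_div_cancel two_ne_zero, one_mul, Real.rpow_def_of_pos (hκpos e), hκ,
      neg_neg, hmin, Real.exp_monotone.map_min, Real.exp_zero]
  refine (volume_torus_forall_dist_le_le d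
    (t := fun e => connectionThreshold n d lam (w e.1) (w e.2)) fun e => ?_).trans ?_
  · unfold connectionThreshold
    have := Real.rpow_nonneg (hκpos e).le (1 / (d : ℝ))
    positivity
  simp only [hl]
  rw [← ENNReal.ofReal_prod_of_nonneg fun i _ => by unfold weightFactor; positivity]
  refine ENNReal.ofReal_le_ofReal ?_
  set E : Finset (Fin 4 × Fin 4) := {e | e.1 < e.2} with hE
  have hl0 : ∀ e ∈ E, 0 ≤ l e := fun e _ =>
    neg_nonneg.mpr (div_nonpos_of_nonpos_of_nonneg (min_le_left _ _) hd'.le)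
  have hl1 : ∀ e ∈ E, l e ≤ 1 / 35 := by
    intro e _
    have h1 : Real.log (lam * w₀ ^ 2 / n) ≤ y e.1 + y e.2 := by
      rw [← hκ]
      refine Real.log_le_log (by positivity) ?_
      rw [sq, ← mul_assoc]
      have := (hwp e.1).le
      gcongr
      exacts [hw _, hw _]
    rw [← inv_div, Real.log_inv] at h1
    have h2 : -(d / 35 : ℝ) ≤ min 0 (y e.1 + y e.2) :=
      le_min (by linarith) (by linarith)
    change -(min 0 (y e.1 + y e.2) / d) ≤ 1 / 35
    rw [← neg_div, div_le_iff₀ hd']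
    linarith
  have hbound := inv_one_add_sum_one_sub_exp_neg_le E (by decide) hl0 hl1
  have hSnonneg : 0 ≤ ∑ e ∈ E, (1 - Real.exp (-l e)) := Finset.sum_nonneg fun e he =>
    sub_nonneg.mpr (Real.exp_le_one_iff.mpr (neg_nonpos.mpr (hl0 e he)))
  refine (pow_le_pow_left₀ (inv_nonneg.mpr (by linarith)) hbound d).trans ?_
  unfold weightFactor
  rw [← Real.exp_nat_mul, ← Real.exp_sum]
  refine Real.exp_le_exp.mpr (le_of_eq_of_le ?_ (sum_pair_min_zero_le y))
  have : ∑ e ∈ E, l e = -((∑ e ∈ E, min 0 (y e.1 + y e.2)) / d) := by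
    rw [Finset.sum_div, Finset.sum_neg_distrib]
  rw [this]
  field_simp
  rfl

/-! ### First moment of the number of 4-cliques -/

/-- The event that four vertex samples are pairwise within the connection threshold. -/
def fourCliqueEvent (n d : ℕ) (lam : ℝ) : Set (Fin 4 → VertexSample d) :=
  {x | ∀ e : Fin 4 × Fin 4, e.1 < e.2 →
    dist (x e.1).2 (x e.2).2 ≤ connectionThreshold n d lam (x e.1).1 (x e.2).1}

theorem measurableSet_forall_dist_le_connectionThreshold {α : Type*} [MeasurableSpace α]
    (n d : ℕ) (lam : ℝ) {W : Fin 4 → α → ℝ} {X : Fin 4 → α → UnitAddTorus (Fin d)}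
    (hW : ∀ i, Measurable (W i)) (hX : ∀ i, Measurable (X i)) :
    MeasurableSet {a | ∀ e : Fin 4 × Fin 4, e.1 < e.2 →
      dist (X e.1 a) (X e.2 a) ≤ connectionThreshold n d lam (W e.1 a) (W e.2 a)} := by
  have : {a | ∀ e : Fin 4 × Fin 4, e.1 < e.2 →
      dist (X e.1 a) (X e.2 a) ≤ connectionThreshold n d lam (W e.1 a) (W e.2 a)} =
      ⋂ e : Fin 4 × Fin 4, ⋂ _ : e.1 < e.2,
        {a | dist (X e.1 a) (X e.2 a) ≤ connectionThreshold n d lam (W e.1 a) (W e.2 a)} := by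
    ext y; simp
  rw [this]
  unfold connectionThreshold
  exact MeasurableSet.iInter fun e => MeasurableSet.iInter fun _ =>
    measurableSet_le ((hX e.1).dist (hX e.2))
      ((((((hW e.1).const_mul lam).mul (hW e.2)).div_const _).pow_const _).const_mul _)

theorem measurableSet_fourCliqueEvent (n d : ℕ) (lam : ℝ) :
    MeasurableSet (fourCliqueEvent n d lam) :=
  measurableSet_forall_dist_le_connectionThreshold n d lam
    (W := fun i (x : Fin 4 → VertexSample d) => (x i).1)
    (X := fun i (x : Fin 4 → VertexSample d) => (x i).2)
    (fun i => by fun_prop) (fun i => by fun_prop)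

theorem ae_le_paretoMeasure (w₀ r : ℝ) : ∀ᵐ w ∂paretoMeasure w₀ r, w₀ ≤ w := by
  rw [ae_iff]
  simp only [not_le]
  change paretoMeasure w₀ r (Set.Iio w₀) = 0
  rw [paretoMeasure, withDensity_apply _ measurableSet_Iio]
  exact lintegral_paretoPDF_of_le le_rfl

theorem isProbabilityMeasure_vertexLaw {β w₀ : ℝ} (hβ : 1 < β) (hw₀ : 0 < w₀) (d : ℕ) :
    IsProbabilityMeasure (vertexLaw β w₀ d) := by
  have := isProbabilityMeasure_paretoMeasure hw₀ (sub_pos.mpr hβ)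
  have := isProbabilityMeasure_volume_unitAddCircle
  unfold vertexLaw
  infer_instance

theorem measure_fourCliqueEvent_le {lam w₀ : ℝ} (hlam : 0 < lam)
    (hw₀ : 0 < w₀) {n d : ℕ} (hn : 0 < n) (hd : 0 < d)
    (hnd : Real.log (n / (lam * w₀ ^ 2)) ≤ d / 35) :
    (Measure.pi fun _ => vertexLaw 3 w₀ d) (fourCliqueEvent n d lam) ≤
      ENNReal.ofReal (24 * w₀ ^ 2 * lam / n) ^ 4 := by
  have hn' : (0 : ℝ) < n := by exact_mod_cast hn
  have h31 : (3 - 1 : ℝ) = 2 := by norm_num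
  have := isProbabilityMeasure_paretoMeasure hw₀ two_pos
  have := isProbabilityMeasure_volume_unitAddCircle
  unfold vertexLaw
  rw [h31]
  have hmp := measurePreserving_arrowProdEquivProdArrow ℝ (UnitAddTorus (Fin d)) (Fin 4)
    (fun _ => paretoMeasure w₀ 2) (fun _ => volume)
  let A : Set ((Fin 4 → ℝ) × (Fin 4 → UnitAddTorus (Fin d))) :=
    {a | ∀ e : Fin 4 × Fin 4, e.1 < e.2 →
      dist (a.2 e.1) (a.2 e.2) ≤ connectionThreshold n d lam (a.1 e.1) (a.1 e.2)}
  have hA : MeasurableSet A := measurableSet_forall_dist_le_connectionThreshold n d lam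
    (W := fun i (a : (Fin 4 → ℝ) × (Fin 4 → UnitAddTorus (Fin d))) => a.1 i)
    (X := fun i (a : (Fin 4 → ℝ) × (Fin 4 → UnitAddTorus (Fin d))) => a.2 i)
    (fun i => by fun_prop) (fun i => by fun_prop)
  have hpre : fourCliqueEvent n d lam =
      MeasurableEquiv.arrowProdEquivProdArrow ℝ (UnitAddTorus (Fin d)) (Fin 4) ⁻¹' A := rfl
  rw [hpre, hmp.measure_preimage hA.nullMeasurableSet, Measure.prod_apply hA]
  have hae : ∀ᵐ w ∂(Measure.pi fun _ : Fin 4 => paretoMeasure w₀ 2), ∀ i, w₀ ≤ w i :=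
    ae_all_iff.mpr fun i => (measurePreserving_eval (fun _ : Fin 4 => paretoMeasure w₀ 2)
      i).quasiMeasurePreserving.ae (ae_le_paretoMeasure w₀ 2)
  have hb : 0 < √(lam / n) := Real.sqrt_pos.mpr (by positivity)
  refine (lintegral_mono_ae (g := fun w => ∏ i, ENNReal.ofReal (weightFactor (√(lam / n) * w i)))
    ?_).trans ?_
  · filter_upwards [hae] with w hw
    exact volume_torus_forall_dist_le_connectionThreshold_le hlam hw₀ hn hd hnd hw
  · rw [lintegral_pi_prod_eq_prod_lintegral (paretoMeasure w₀ 2)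
      (g := fun w => ENNReal.ofReal (weightFactor (√(lam / n) * w)))
      (measurable_weightFactor.comp (measurable_const_mul _)).ennreal_ofReal, Fintype.card_fin]
    have h := lintegral_weightFactor_paretoMeasure_le hw₀ hb
    rw [Real.sq_sqrt (by positivity), ← mul_div_assoc] at h
    gcongr

/-- Listing a clique in increasing order gives one embedding per clique; the other orderings only
enlarge the sum. -/
theorem cliqueCount_le_sum_indicator {n d : ℕ} (lam : ℝ) (x : Fin n → VertexSample d) :
    (cliqueCount (girg n d lam x) 4 : ENNReal) ≤
      ∑ e : Fin 4 ↪ Fin n, (fourCliqueEvent n d lam).indicator 1 fun i => x (e i) := by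
  classical
  let T : Finset (Fin 4 ↪ Fin n) := {e | (fun i => x (e i)) ∈ fourCliqueEvent n d lam}
  have hsub : (girg n d lam x).cliqueSet 4 ⊆
      (T.image fun e => Finset.univ.map e : Finset (Finset (Fin n))) := by
    intro s hs
    rw [SimpleGraph.mem_cliqueSet_iff, SimpleGraph.isNClique_iff] at hs
    have himg : Finset.univ.map (s.orderEmbOfFin hs.2).toEmbedding = s := by
      ext v
      simp
    rw [Finset.mem_coe, Finset.mem_image]
    refine ⟨(s.orderEmbOfFin hs.2).toEmbedding, ?_, himg⟩
    simp only [T, Finset.mem_filter, Finset.mem_univ, true_and]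
    intro e he
    exact (hs.1 (s.orderEmbOfFin_mem hs.2 e.1) (s.orderEmbOfFin_mem hs.2 e.2)
      ((s.orderEmbOfFin hs.2).injective.ne he.ne)).2
  have hcard : cliqueCount (girg n d lam x) 4 ≤ T.card := by
    refine (Set.ncard_le_ncard hsub (Finset.finite_toSet _)).trans ?_
    rw [Set.ncard_coe_finset]
    exact Finset.card_image_le
  refine (Nat.cast_le.mpr hcard).trans_eq ?_
  simp only [T, Finset.card_filter, Nat.cast_sum, Set.indicator_apply, Nat.cast_ite, Nat.cast_one,
    Nat.cast_zero, Pi.one_apply]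

theorem measure_le_cliqueCount_le {lam w₀ : ℝ} (hlam : 0 < lam) (hw₀ : 0 < w₀) {n d : ℕ}
    (hn : 0 < n) (hd : 0 < d) (hnd : Real.log (n / (lam * w₀ ^ 2)) ≤ d / 35) {c : ℕ}
    (hc : 0 < c) :
    sampleLaw n 3 w₀ d {x | c ≤ cliqueCount (girg n d lam x) 4} ≤
      ENNReal.ofReal ((24 * w₀ ^ 2 * lam) ^ 4 / c) := by
  have hn' : (0 : ℝ) < n := by exact_mod_cast hn
  have hc' : (0 : ℝ) < c := by exact_mod_cast hc
  have := isProbabilityMeasure_vertexLaw (β := 3) (by norm_num) hw₀ d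
  let g : (Fin n → VertexSample d) → ENNReal := fun x =>
    ∑ e : Fin 4 ↪ Fin n, (fourCliqueEvent n d lam).indicator 1 fun i => x (e i)
  have hE := measurableSet_fourCliqueEvent n d lam
  have hind : Measurable ((fourCliqueEvent n d lam).indicator (1 : (Fin 4 → VertexSample d) → ENNReal)) :=
    measurable_one.indicator hE
  have hgi (e : Fin 4 ↪ Fin n) : Measurable fun x : Fin n → VertexSample d =>
      (fourCliqueEvent n d lam).indicator (1 : (Fin 4 → VertexSample d) → ENNReal) fun i => x (e i) :=
    hind.comp (by fun_prop)
  have hg : Measurable g := Finset.measurable_sum _ fun e _ => hgi e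
  have hint : ∫⁻ x, g x ∂(sampleLaw n 3 w₀ d) ≤ ENNReal.ofReal ((24 * w₀ ^ 2 * lam) ^ 4) := by
    rw [lintegral_finsetSum _ fun e _ => hgi e]
    have hone (e : Fin 4 ↪ Fin n) :
        ∫⁻ x, (fourCliqueEvent n d lam).indicator 1 (fun i => x (e i)) ∂(sampleLaw n 3 w₀ d) ≤
          ENNReal.ofReal (24 * w₀ ^ 2 * lam / n) ^ 4 := by
      have hmp := measurePreserving_pi_precomp (vertexLaw 3 w₀ d) e.injective
      rw [sampleLaw, hmp.lintegral_comp hind, lintegral_indicator_one hE]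
      exact measure_fourCliqueEvent_le hlam hw₀ hn hd hnd
    refine (Finset.sum_le_card_nsmul _ _ _ fun e _ => hone e).trans ?_
    have hcard : Fintype.card (Fin 4 ↪ Fin n) ≤ n ^ 4 := by
      rw [Fintype.card_embedding_eq, Fintype.card_fin, Fintype.card_fin]
      exact Nat.descFactorial_le_pow n 4
    rw [Finset.card_univ, nsmul_eq_mul]
    refine (mul_le_mul_left (Nat.cast_le.mpr hcard) _).trans_eq ?_
    rw [← ENNReal.ofReal_pow (by positivity), ← ENNReal.ofReal_natCast,
      ← ENNReal.ofReal_mul (by positivity)]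
    congr 1
    push_cast
    field_simp
  have hsub : {x | c ≤ cliqueCount (girg n d lam x) 4} ⊆ {x | (c : ENNReal) ≤ g x} :=
    fun x hx => (Nat.cast_le.mpr hx).trans (cliqueCount_le_sum_indicator lam x)
  refine (measure_mono hsub).trans ((meas_ge_le_lintegral_div hg.aemeasurable
    (by exact_mod_cast hc.ne') (ENNReal.natCast_ne_top c)).trans ?_)
  rw [ENNReal.ofReal_div_of_pos hc', ENNReal.ofReal_natCast]
  gcongr

/-! ### Tightness, uniformly in n -/

theorem eventually_log_div_le_of_log_isLittleO {d : ℕ → ℕ}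
    (hd : (fun n : ℕ => Real.log n) =o[atTop] fun n : ℕ => (d n : ℝ)) {a δ : ℝ} (ha : 0 < a)
    (hδ : 0 < δ) : ∀ᶠ n : ℕ in atTop, 0 < n ∧ 0 < d n ∧ Real.log (n / a) ≤ d n * δ := by
  have hlog : Tendsto (fun n : ℕ => Real.log n) atTop atTop :=
    Real.tendsto_log_atTop.comp tendsto_natCast_atTop_atTop
  filter_upwards [eventually_gt_atTop 0, hd.bound (half_pos hδ), hlog.eventually_gt_atTop 0,
    hlog.eventually_ge_atTop (-Real.log a)] with n hn hb hpos hge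
  have hn' : (0 : ℝ) < n := by exact_mod_cast hn
  rw [Real.norm_of_nonneg hpos.le, Real.norm_of_nonneg (Nat.cast_nonneg _)] at hb
  refine ⟨hn, ?_, ?_⟩
  · rcases Nat.eq_zero_or_pos (d n) with h | h
    · rw [h] at hb; simp at hb; linarith
    · exact h
  · rw [Real.log_div hn'.ne' ha.ne']
    linarith

theorem cliqueCount_le_two_pow {n : ℕ} (G : SimpleGraph (Fin n)) (k : ℕ) :
    cliqueCount G k ≤ 2 ^ n := by
  refine (Set.ncard_le_ncard (Set.subset_univ _) Set.finite_univ).trans ?_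
  simp [Set.ncard_univ]

theorem exists_measure_le_cliqueCount_le {lam w₀ : ℝ} (hlam : 0 < lam) (hw₀ : 0 < w₀)
    {d : ℕ → ℕ} (hd : (fun n : ℕ => Real.log n) =o[atTop] fun n : ℕ => (d n : ℝ)) {ε : ℝ}
    (hε : 0 < ε) : ∃ c : ℕ, ∀ n : ℕ,
      sampleLaw n 3 w₀ (d n) {x | c ≤ cliqueCount (girg n (d n) lam x) 4} ≤ ENNReal.ofReal ε := by
  obtain ⟨N, hN⟩ := eventually_atTop.mp (eventually_log_div_le_of_log_isLittleO hd
    (a := lam * w₀ ^ 2) (δ := 1 / 35) (by positivity) (by norm_num))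
  obtain ⟨c, hc⟩ := exists_nat_gt ((24 * w₀ ^ 2 * lam) ^ 4 / ε)
  have hc0 : 0 < c := by
    have : (0 : ℝ) < c := lt_of_le_of_lt (by positivity) hc
    exact_mod_cast this
  -- For n < N the first moment bound may fail, but a graph on n vertices has at most 2^n cliques,
  -- so the event is empty.
  refine ⟨max c (2 ^ N + 1), fun n => ?_⟩
  rcases lt_or_ge n N with h | h
  · have : {x | max c (2 ^ N + 1) ≤ cliqueCount (girg n (d n) lam x) 4} = ∅ := by
      refine Set.eq_empty_of_forall_notMem fun x hx => ?_
      have h1 := cliqueCount_le_two_pow (girg n (d n) lam x) 4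
      have h2 : 2 ^ n ≤ 2 ^ N := Nat.pow_le_pow_right (by norm_num) h.le
      have h3 : 2 ^ N + 1 ≤ cliqueCount (girg n (d n) lam x) 4 := (le_max_right c _).trans hx
      omega
    rw [this, measure_empty]
    exact zero_le
  · obtain ⟨hn, hdn, hlog⟩ := hN n h
    rw [mul_one_div] at hlog
    have hc' : (0 : ℝ) < c := by exact_mod_cast hc0
    have hsub : {x | max c (2 ^ N + 1) ≤ cliqueCount (girg n (d n) lam x) 4} ⊆
        {x | c ≤ cliqueCount (girg n (d n) lam x) 4} := fun x hx => (le_max_left c _).trans hx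
    refine (measure_mono hsub).trans
      ((measure_le_cliqueCount_le hlam hw₀ hn hdn hlog hc0).trans
        (ENNReal.ofReal_le_ofReal ?_))
    rw [div_lt_iff₀ hε] at hc
    rw [div_le_iff₀ hc']
    linarith

/-! ### The clique number -/

theorem le_choose_four (c : ℕ) : c ≤ (c + 3).choose 4 := by
  induction c with
  | zero => simp
  | succ c ih =>
    rw [show c + 1 + 3 = (c + 3) + 1 by ring, Nat.choose_succ_succ']
    have : 0 < (c + 3).choose 3 := Nat.choose_pos (by omega)
    change c + 1 ≤ (c + 3).choose 3 + (c + 3).choose 4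
    omega

/-- All 4-subsets of a maximum clique are 4-cliques. -/
theorem le_cliqueCount_four_of_le_cliqueNum {n c : ℕ} {G : SimpleGraph (Fin n)}
    (h : c + 3 ≤ G.cliqueNum) : c ≤ cliqueCount G 4 := by
  obtain ⟨s, hs⟩ := G.exists_isNClique_cliqueNum
  have hsub : (s.powersetCard 4 : Set (Finset (Fin n))) ⊆ G.cliqueSet 4 := by
    intro t ht
    rw [Finset.mem_coe, Finset.mem_powersetCard] at ht
    exact ⟨hs.isClique.subset (Finset.coe_subset.mpr ht.1), ht.2⟩
  have h1 := Set.ncard_le_ncard hsub (Set.toFinite _)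
  rw [Set.ncard_coe_finset, Finset.card_powersetCard, hs.card_eq] at h1
  exact (le_choose_four c).trans ((Nat.choose_le_choose 4 h).trans h1)

theorem mainTheorem7 (lam w₀ : ℝ) (hlam : 0 < lam) (hw₀ : 0 < w₀)
    (d : ℕ → ℕ) (hd : (fun n : ℕ => Real.log n) =o[atTop] fun n : ℕ => (d n : ℝ)) :
    -- the number of 4-cliques is bounded in probability
    (∀ ε : ℝ, 0 < ε → ∃ c : ℕ, ∀ n : ℕ,
      sampleLaw n 3 w₀ (d n) {x | c ≤ cliqueCount (girg n (d n) lam x) 4} ≤ ENNReal.ofReal ε) ∧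
    -- the clique number is bounded in probability
    (∀ ε : ℝ, 0 < ε → ∃ c : ℕ, ∀ n : ℕ,
      sampleLaw n 3 w₀ (d n) {x | c ≤ (girg n (d n) lam x).cliqueNum} ≤ ENNReal.ofReal ε) ∧
    -- a.a.s. the clique number stays below any given function that tends to infinity
    (∀ f : ℕ → ℝ, Tendsto f atTop atTop →
      Tendsto (fun n : ℕ =>
          sampleLaw n 3 w₀ (d n) {x | f n ≤ ((girg n (d n) lam x).cliqueNum : ℝ)})
        atTop (𝓝 0)) := by
  have hclique (ε : ℝ) (hε : 0 < ε) : ∃ c : ℕ, ∀ n : ℕ,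
      sampleLaw n 3 w₀ (d n) {x | c ≤ (girg n (d n) lam x).cliqueNum} ≤ ENNReal.ofReal ε := by
    obtain ⟨c, hc⟩ := exists_measure_le_cliqueCount_le hlam hw₀ hd hε
    exact ⟨c + 3, fun n =>
      (measure_mono fun x hx => le_cliqueCount_four_of_le_cliqueNum hx).trans (hc n)⟩
  refine ⟨fun ε hε => exists_measure_le_cliqueCount_le hlam hw₀ hd hε, hclique, fun f hf => ?_⟩
  rw [ENNReal.tendsto_nhds_zero]
  intro ε hε
  obtain ⟨δ, hδ0, hδ⟩ := ENNReal.lt_iff_exists_nnreal_btwn.mp hε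
  obtain ⟨c, hc⟩ := hclique δ (by exact_mod_cast hδ0)
  filter_upwards [hf.eventually_ge_atTop (c : ℝ)] with n hn
  refine (measure_mono fun x hx => ?_).trans ((hc n).trans ?_)
  · exact_mod_cast hn.trans hx
  · rw [ENNReal.ofReal_coe_nnreal]
    exact hδ.le
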